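/- Let $K=\mathbf C((x))$, let $\overline K=\bigcup_{d\ge 1}\mathbf C[[x^{1/d}]][1/x]$ be the field of Puiseux series with its natural valuation $\nu:\overline K\to\mathbf Q\cup\{+\infty\}$, and let $f\in\mathbf C[[x]][y]$ be a distinguished polynomial of degree $n\ge 2$ in $y$ (that is, $f$ is monic and $f(0,y)=y^n$) which is reduced (squarefree). Let $a_1,\dots,a_n\in\overline K$ be its roots, which are pairwise distinct, and let $d$ be the least common multiple of the degrees in $y$ of the irreducible factors of $f$. For $w\in K[y]$ of degree less than $n$ put $$\operatorname{val}(w)=\min_{1\le i\le n}\nu\!\left(\frac{w(x,a_i)}{f'_y(x,a_i)}\right).$$ For $r\in\mathbf Q$ let $\mathcal E_r$ (resp. $\mathcal E_{>r}$) be the set of $w\in K[y]$ of degree less than $n$ with $\operatorname{val}(w)\ge r$ (resp. $\operatorname{val}(w)>r$), and let $\mathcal F_r$ be the set of elements of $\mathcal E_r$ of degree less than $n-1$. Then: 1. For every $r\in\frac1d\mathbf Z$, $$\mathcal F_r f\subset \mathcal F_{r+1}f'_x+\mathcal E_{>r}f'_y ,$$ that is, for every $w\in\mathcal F_r$ there are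 $u\in\mathcal F_{r+1}$ and $v\in\mathcal E_{>r}$ with $wf=uf'_x+vf'_y$. 2. Every $w\in\mathcal E_0$ lies in $\mathbf C[[x]][y]$, and $wf$ lies in the Jacobian ideal $(f'_x,f'_y)\mathbf C[[x]][y]$. 3. $f^2$ lies in the Jacobian ideal $(f'_x,f'_y)\mathbf C[[x]][y]$. -/

import Mathlib

open Polynomial

noncomputable section

namespace JacobianDivision

/-- The ring homomorphism `ℂ((t)) → ℂ⟦t^ℚ⟧` substituting `t = x^(1/d)`: the coefficient of `t^k`
becomes the coefficient of `x^(k/d)`. -/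
def ramify (d : ℕ+) : LaurentSeries ℂ →+* HahnSeries ℚ ℂ :=
  HahnSeries.embDomainRingHom
    ((AddMonoidHom.mulRight ((d : ℚ)⁻¹)).comp (Int.castAddHom ℚ))
    (by
      intro a b h
      have hd : ((d : ℕ) : ℚ) ≠ 0 := by exact_mod_cast d.ne_zero
      simpa [hd] using h)
    (by
      intro a b
      have hd : (0 : ℚ) < ((d : ℕ) : ℚ) := by exact_mod_cast d.pos
      simp [hd])

theorem ramify_coeff (d : ℕ+) (f : LaurentSeries ℂ) (k : ℤ) :
    (ramify d f).coeff ((k : ℚ) * (d : ℚ)⁻¹) = f.coeff k := by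
  exact HahnSeries.embDomain_coeff (f := ⟨⟨fun k : ℤ => (k : ℚ) * (d : ℚ)⁻¹, _⟩, _⟩) (a := k)

theorem ramify_coeff_of_notMem (d : ℕ+) (f : LaurentSeries ℂ) (q : ℚ)
    (hq : ∀ k : ℤ, q ≠ (k : ℚ) * (d : ℚ)⁻¹) : (ramify d f).coeff q = 0 := by
  refine HahnSeries.embDomain_of_notMem_range ?_
  rintro ⟨k, hk⟩
  exact hq k hk.symm

/-- `ℂ((x^(1/d))) = ℂ⟦x^(1/d)⟧[1/x]`, as a subfield of the Hahn series field `ℂ⟦x^ℚ⟧`. -/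
def ramifiedField (d : ℕ+) : Subfield (HahnSeries ℚ ℂ) := (ramify d).fieldRange

/-- The field `K̄ = ⋃_{d ≥ 1} ℂ⟦x^(1/d)⟧[1/x]` of Puiseux series; see `mem_puiseux_iff`. -/
def Puiseux : Subfield (HahnSeries ℚ ℂ) := ⨆ d : ℕ+, ramifiedField d

theorem mem_ramifiedField_iff (d : ℕ+) (a : HahnSeries ℚ ℂ) :
    a ∈ ramifiedField d ↔ ∀ q ∈ a.support, ∃ k : ℤ, q = (k : ℚ) * (d : ℚ)⁻¹ := by
  constructor
  · rintro ⟨f, rfl⟩ q hq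
    by_contra! h
    exact hq (ramify_coeff_of_notMem d f q h)
  · intro h
    have hd : (0 : ℚ) < ((d : ℕ) : ℚ) := by exact_mod_cast d.pos
    have hmono : StrictMono (fun k : ℤ => (k : ℚ) * (d : ℚ)⁻¹) := by
      intro k l hkl
      have : (k : ℚ) < l := by exact_mod_cast hkl
      have hd' : (0 : ℚ) < (d : ℚ)⁻¹ := inv_pos.mpr hd
      exact mul_lt_mul_of_pos_right this hd'
    refine ⟨⟨fun k => a.coeff ((k : ℚ) * (d : ℚ)⁻¹), ?_⟩, ?_⟩
    · intro g
      obtain ⟨m, n, hmn, hle⟩ :=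
        a.isPWO_support fun m => ⟨((g m : ℤ) : ℚ) * (d : ℚ)⁻¹, (g m).2⟩
      exact ⟨m, n, hmn, hmono.le_iff_le.mp hle⟩
    · ext q
      by_cases hq : ∃ k : ℤ, q = (k : ℚ) * (d : ℚ)⁻¹
      · obtain ⟨k, rfl⟩ := hq
        rw [ramify_coeff]
      · rw [ramify_coeff_of_notMem d _ q (by push Not at hq; exact hq)]
        by_contra hne
        exact hq (h q (Ne.symm hne))

theorem ramifiedField_mono {d e : ℕ+} (h : d ∣ e) : ramifiedField d ≤ ramifiedField e := by
  intro a ha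
  rw [mem_ramifiedField_iff] at ha ⊢
  intro q hq
  obtain ⟨k, rfl⟩ := ha q hq
  obtain ⟨c, rfl⟩ := h
  refine ⟨k * (c : ℕ), ?_⟩
  have hd : ((d : ℕ) : ℚ) ≠ 0 := by exact_mod_cast d.ne_zero
  have hc : ((c : ℕ) : ℚ) ≠ 0 := by exact_mod_cast c.ne_zero
  push_cast
  field_simp

theorem mem_puiseux_iff (a : HahnSeries ℚ ℂ) :
    a ∈ Puiseux ↔ ∃ d : ℕ+, ∀ q ∈ a.support, ∃ k : ℤ, q = (k : ℚ) / (d : ℚ) := by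
  have hdir : Directed (· ≤ ·) ramifiedField := fun d e =>
    ⟨d * e, ramifiedField_mono (dvd_mul_right d e), ramifiedField_mono (dvd_mul_left e d)⟩
  rw [Puiseux, Subfield.mem_iSup_of_directed hdir]
  simp only [mem_ramifiedField_iff, div_eq_mul_inv]

/-- The inclusion of `K = ℂ((x))` into the field `K̄` of Puiseux series. -/
def toPuiseux : LaurentSeries ℂ →+* Puiseux :=
  (ramify 1).codRestrict Puiseux
    fun f => (le_iSup ramifiedField 1 : ramifiedField 1 ≤ Puiseux) ⟨f, rfl⟩

/-- The natural valuation `ν : K̄ → ℚ ∪ {+∞}`: the least exponent with a nonzero coefficient. -/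
def nu (a : Puiseux) : WithTop ℚ := (a : HahnSeries ℚ ℂ).orderTop

/-- The inclusion `ℂ⟦x⟧[y] → K[y]`. -/
def toK : (PowerSeries ℂ)[X] →+* (LaurentSeries ℂ)[X] :=
  Polynomial.mapRingHom (algebraMap (PowerSeries ℂ) (LaurentSeries ℂ))

/-- The inclusion `K[y] → K̄[y]`. -/
def toKbar : (LaurentSeries ℂ)[X] →+* Puiseux[X] :=
  Polynomial.mapRingHom toPuiseux

/-- The partial derivative `f'_x`: differentiate each coefficient with respect to `x`. -/
def derivX (f : (PowerSeries ℂ)[X]) : (PowerSeries ℂ)[X] :=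
  PolynomialModule.equivPolynomialSelf ((PowerSeries.derivative ℂ).mapCoeffs f)

theorem coeff_derivX (f : (PowerSeries ℂ)[X]) (k : ℕ) :
    (derivX f).coeff k = PowerSeries.derivative ℂ (f.coeff k) := rfl

/-- The partial derivative `f'_y`. -/
def derivY (f : (PowerSeries ℂ)[X]) : (PowerSeries ℂ)[X] := Polynomial.derivative f

/-- `f` is monic and `f(0, y) = y ^ n`, where `n` is the degree of `f`. -/
def IsDistinguished (f : (PowerSeries ℂ)[X]) : Prop :=
  f.Monic ∧ f.map PowerSeries.constantCoeff = X ^ f.natDegree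

/-- The least common multiple of the degrees in `y` of the irreducible factors of `f`. -/
def lcmFactorDegrees (f : (PowerSeries ℂ)[X]) : ℕ :=
  ((UniqueFactorizationMonoid.factors f).map natDegree).lcm

open Classical in
/-- The set of roots `a_1, …, a_n` of `f` in `K̄`. -/
def branches (f : (PowerSeries ℂ)[X]) : Finset Puiseux := (toKbar (toK f)).roots.toFinset

/-- `val(w) = inf_i ν (w(x, a_i) / f'_y(x, a_i))`, the infimum being over the roots of `f`. By
Lagrange interpolation, `w(x, a_i) / f'_y(x, a_i)` is the `i`-th coordinate of `w`, of degree
less than `n`, in the basis `ε_i = ∏_{j ≠ i} (y - a_j)`. -/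
def val (f : (PowerSeries ℂ)[X]) (w : Puiseux[X]) : WithTop ℚ :=
  (branches f).inf fun a => nu (w.eval a / (toKbar (toK (derivY f))).eval a)

/-- `E_r`: elements of `K[y]` of degree less than `n`, with `val ≥ r`. -/
def E (f : (PowerSeries ℂ)[X]) (r : ℚ) : Set (LaurentSeries ℂ)[X] :=
  {w | w ∈ degreeLT (LaurentSeries ℂ) f.natDegree ∧ (r : WithTop ℚ) ≤ val f (toKbar w)}

/-- `E_{>r}`: elements of `K[y]` of degree less than `n`, with `val > r`. -/
def EGt (f : (PowerSeries ℂ)[X]) (r : ℚ) : Set (LaurentSeries ℂ)[X] :=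
  {w | w ∈ degreeLT (LaurentSeries ℂ) f.natDegree ∧ (r : WithTop ℚ) < val f (toKbar w)}

/-- `F_r`: elements of `K[y]` of degree less than `n - 1`, with `val ≥ r`. -/
def F (f : (PowerSeries ℂ)[X]) (r : ℚ) : Set (LaurentSeries ℂ)[X] :=
  {w | w ∈ degreeLT (LaurentSeries ℂ) (f.natDegree - 1) ∧ (r : WithTop ℚ) ≤ val f (toKbar w)}

/-- The Jacobian ideal `(f'_x, f'_y)` of `ℂ⟦x⟧[y]`. -/
def jacobianIdeal (f : (PowerSeries ℂ)[X]) : Ideal (PowerSeries ℂ)[X] :=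
  Ideal.span {derivX f, derivY f}

end JacobianDivision

end

open JacobianDivision

/-! Factor `f` over the Puiseux field and put `ε_i = ∏_{j≠i} (y - a_j)`. If `u = ∑ c_i ε_i`, then
`f'_y = ∑ ε_i` and `f'_x = -∑ a_i' ε_i`. From `w f = u f'_x + v f'_y`, evaluation at `a_i` forces `v
= ∑ c_i a_i' ε_i`; cancelling `f` and evaluating at `a_l` shows that the `l`-th coordinate of `w` is
`∑_j (c_l - c_j) (a_l - a_j)' / (a_l - a_j)` (`eval_eq_of_mul_nodal_eq`).

After multiplication by `x`, the logarithmic derivative is integral with constant term `ν(a_l - a_j)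
> 0`. Suppose `ρ = min ν(c_i) < val w + 1`. The coefficients `γ_i` of `x^ρ` in the `c_i` then
satisfy `∑_j ν(a_l - a_j) (γ_l - γ_j) = 0` for all `l`, so they are all equal by a maximum
principle. But `deg u < n - 1` means `∑ c_i = 0`, so all `γ_i` vanish, a contradiction. Hence `val u
≥ val w + 1`, and `val v > val w` because `ν(x a_i') > 0` (`le_val_and_lt_val_of_mul_eq`).

For `w = 0` the same estimate makes `(u, v) ↦ u f'_x + v f'_y` injective, hence bijective onto
degree `< 2n - 1` by dimension; this gives `u` and `v`. The ideal statements follow by correcting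
with a multiple of `f'_y` to reach `F_0`. The roots exist by Newton–Puiseux, proved here from
Weierstrass preparation. -/

noncomputable section

/-! ### Factoring monic polynomials by Weierstrass preparation -/

/-- Over a complete local ring, a monic polynomial whose reduction is divisible by `X` without
being a power of `X` has a nontrivial monic factor. -/
theorem Polynomial.Monic.exists_factor_of_map_residue {A : Type*} [CommRing A] [IsLocalRing A]
    [IsAdicComplete (IsLocalRing.maximalIdeal A) A] {Q : A[X]} (hQ : Q.Monic)
    (h0 : (Q.map (IsLocalRing.residue A)).coeff 0 = 0)
    (hne : Q.map (IsLocalRing.residue A) ≠ X ^ Q.natDegree) :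
    ∃ F : A[X], F.Monic ∧ 0 < F.natDegree ∧ F.natDegree < Q.natDegree ∧ F ∣ Q := by
  set q := Q.map (IsLocalRing.residue A) with hq
  have hqm : q.Monic := hQ.map _
  have hqd : q.natDegree = Q.natDegree := hQ.natDegree_map _
  have hmap : (Q : PowerSeries A).map (IsLocalRing.residue A) = (q : PowerSeries (IsLocalRing.ResidueField A)) := by
    rw [hq, Polynomial.polynomial_map_coe]
  have hg : (Q : PowerSeries A).map (IsLocalRing.residue A) ≠ 0 := by
    rw [hmap]
    exact_mod_cast hqm.ne_zero
  obtain ⟨F, h, H⟩ := PowerSeries.exists_isWeierstrassFactorization hg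
  have hF : F.Monic := H.isDistinguishedAt.monic
  have hord : (q : PowerSeries (IsLocalRing.ResidueField A)).order = (q.natTrailingDegree : ℕ∞) := by
    rw [PowerSeries.order_eq_nat]
    refine ⟨?_, fun i hi => ?_⟩
    · rw [Polynomial.coeff_coe]
      exact Polynomial.trailingCoeff_nonzero_iff_nonzero.2 hqm.ne_zero
    · rw [Polynomial.coeff_coe]
      exact Polynomial.coeff_eq_zero_of_lt_natTrailingDegree hi
  have hdeg : F.natDegree = q.natTrailingDegree := by
    rw [H.natDegree_eq_toNat_order_map, hmap, hord, ENat.toNat_natCast]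
  refine ⟨F, hF, ?_, ?_, ?_⟩
  · rw [hdeg, Nat.pos_iff_ne_zero]
    intro h
    rcases Polynomial.natTrailingDegree_eq_zero.1 h with h | h
    · exact hqm.ne_zero h
    · exact h h0
  · rw [hdeg, ← hqd]
    refine lt_of_le_of_ne (Polynomial.natTrailingDegree_le_natDegree q) fun h => hne ?_
    rw [← hqd]
    exact hqm.eq_X_pow_iff_natTrailingDegree_eq_natDegree.2 h
  -- `F` divides `Q` only as power series so far. Euclidean division by the monic `F` is also a
  -- Weierstrass division, and uniqueness of the latter makes the polynomial remainder zero.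
  · have HF : (F : PowerSeries A).IsWeierstrassFactorization F 1 :=
      ⟨H.isDistinguishedAt, isUnit_one, by simp⟩
    have hFd := HF.natDegree_eq_toNat_order_map
    have e1 : (Q : PowerSeries A).IsWeierstrassDivision F h 0 :=
      ⟨by simp, by simpa using H.eq_mul⟩
    have e2 : (Q : PowerSeries A).IsWeierstrassDivision F ((Q /ₘ F : A[X]) : PowerSeries A)
        (Q %ₘ F) := by
      refine ⟨?_, ?_⟩
      · have := Polynomial.degree_modByMonic_lt Q hF
        rw [Polynomial.degree_eq_natDegree hF.ne_zero, hFd] at this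
        exact this
      · conv_lhs => rw [← Polynomial.modByMonic_add_div Q F]
        push_cast
        ring
    have := (e1.elim HF.map_ne_zero e2).2
    exact (Polynomial.modByMonic_eq_zero_iff_dvd hF).1 this.symm

instance : IsAdicComplete (IsLocalRing.maximalIdeal (PowerSeries ℂ)) (PowerSeries ℂ) := by
  rw [PowerSeries.maximalIdeal_eq_span_X]
  infer_instance

/-- Translate a root `c` of the reduction to the origin. If `c` were its only root, the vanishing
sum of roots would give `n c = 0`, so `c = 0` and the reduction would be the excluded power of `X`.
-/
theorem Polynomial.Monic.exists_factor_of_nextCoeff_eq_zero {Q : (PowerSeries ℂ)[X]}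
    (hQ : Q.Monic) (hn : 2 ≤ Q.natDegree)
    (h0 : (Q.map PowerSeries.constantCoeff).nextCoeff = 0)
    (hne : Q.map PowerSeries.constantCoeff ≠ X ^ Q.natDegree) :
    ∃ F : (PowerSeries ℂ)[X], F.Monic ∧ 0 < F.natDegree ∧ F.natDegree < Q.natDegree ∧ F ∣ Q := by
  set q := Q.map (PowerSeries.constantCoeff (R := ℂ)) with hq
  have hqm : q.Monic := hQ.map _
  have hqd : q.natDegree = Q.natDegree := hQ.natDegree_map _
  obtain ⟨c, hc⟩ := IsAlgClosed.exists_root q (by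
    rw [Polynomial.degree_eq_natDegree hqm.ne_zero, hqd]
    exact_mod_cast (by omega : Q.natDegree ≠ 0))
  set Q' := taylor (PowerSeries.C c) Q with hQ'
  have hd' : Q'.natDegree = Q.natDegree := natDegree_taylor _ _
  have hmap : Q'.map PowerSeries.constantCoeff = taylor c q := by
    simp [hQ', hq, taylor_apply, Polynomial.map_comp]
  have hker : ∀ a : PowerSeries ℂ, IsLocalRing.residue _ a = 0 ↔ PowerSeries.constantCoeff a = 0 := by
    intro a
    rw [IsLocalRing.residue_eq_zero_iff, PowerSeries.maximalIdeal_eq_span_X,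
      Ideal.mem_span_singleton, PowerSeries.X_dvd_iff]
  have hQm : Q'.Monic := by
    rw [Monic, hQ', leadingCoeff_taylor]; exact hQ
  have hres : ∀ k, (Q'.map (IsLocalRing.residue _)).coeff k = 0 ↔ (taylor c q).coeff k = 0 := by
    intro k
    rw [coeff_map, hker, ← hmap, coeff_map]
  obtain ⟨F, hF, h1, h2, h3⟩ := hQm.exists_factor_of_map_residue
    (by rw [hres, taylor_coeff_zero]; exact hc) (by
      intro h
      have h4 : taylor c q = X ^ Q.natDegree := by
        ext k
        rw [coeff_X_pow]
        split_ifs with hk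
        · have : (taylor c q).Monic := by rw [Monic, leadingCoeff_taylor]; exact hqm
          rw [hk, ← hqd, ← natDegree_taylor q c]
          exact this
        · rw [← hres, h, hd', coeff_X_pow, if_neg hk]
      have h5 : q = (X - C c) ^ Q.natDegree := by
        have := congrArg (taylor (-c)) h4
        rw [taylor_taylor, neg_add_cancel, taylor_zero, taylor_X_pow] at this
        rw [this]; simp [sub_eq_add_neg]
      have h6 := h0
      rw [h5, (monic_X_sub_C c).nextCoeff_pow, nextCoeff_X_sub_C] at h6
      have : c = 0 := by
        have : (Q.natDegree : ℂ) ≠ 0 := by exact_mod_cast (by omega : Q.natDegree ≠ 0)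
        simpa [this, show Q.natDegree ≠ 0 by omega] using h6
      subst this
      exact hne (by simpa using h5))
  refine ⟨taylor (-PowerSeries.C c) F, ?_, ?_, ?_, ?_⟩
  · rw [Monic, leadingCoeff_taylor]; exact hF
  · rwa [natDegree_taylor]
  · rw [natDegree_taylor]; omega
  · obtain ⟨G, hG⟩ := h3
    refine ⟨taylor (-PowerSeries.C c) G, ?_⟩
    rw [← taylor_mul, ← hG, hQ', taylor_taylor, neg_add_cancel, taylor_zero]

theorem Polynomial.Monic.nextCoeff_taylor {R : Type*} [CommRing R] [Nontrivial R] {p : R[X]}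
    (hp : p.Monic) (r : R) :
    (taylor r p).nextCoeff = p.nextCoeff + p.natDegree * r := by
  rcases Nat.eq_zero_or_pos p.natDegree with h | h
  · rw [hp.natDegree_eq_zero.1 h]; simp
  · rw [nextCoeff_of_natDegree_pos (by rwa [natDegree_taylor]), natDegree_taylor, taylor_coeff,
      nextCoeff_of_natDegree_pos h, eval_eq_sum_range' (n := 2)]
    · obtain ⟨k, hk⟩ : ∃ k, p.natDegree = k + 1 := ⟨p.natDegree - 1, by omega⟩
      have : p.coeff (k + 1) = 1 := by rw [← hk]; exact hp
      simp [Finset.sum_range_succ, hasseDeriv_coeff, hk, add_comm 1 k, this]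
    · exact lt_of_le_of_lt (natDegree_hasseDeriv_le _ _) (by omega)

/-! ### The Newton–Puiseux theorem -/

namespace JacobianDivision

theorem exists_powerSeries_of_mem_ramifiedField {d : ℕ+} {a : HahnSeries ℚ ℂ}
    (ha : a ∈ ramifiedField d) (h0 : 0 ≤ a.orderTop) :
    ∃ g : PowerSeries ℂ, ramify d (HahnSeries.ofPowerSeries ℤ ℂ g) = a ∧
      PowerSeries.constantCoeff g = a.coeff 0 := by
  obtain ⟨f, rfl⟩ := ha
  have hneg : ∀ k : ℤ, k < 0 → f.coeff k = 0 := by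
    intro k hk
    rw [← ramify_coeff d]
    apply HahnSeries.coeff_eq_zero_of_lt_orderTop
    refine lt_of_lt_of_le ?_ h0
    have hd : (0 : ℚ) < ((d : ℕ) : ℚ)⁻¹ := inv_pos.2 (by exact_mod_cast d.pos)
    have : (k : ℚ) * (d : ℚ)⁻¹ < 0 := mul_neg_of_neg_of_pos (by exact_mod_cast hk) hd
    exact_mod_cast this
  have hf : HahnSeries.ofPowerSeries ℤ ℂ (PowerSeries.mk fun k => f.coeff k) = f := by
    ext k
    rcases lt_or_ge k 0 with hk | hk
    · rw [hneg k hk]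
      have := PowerSeries.coeff_coe (f := PowerSeries.mk fun k : ℕ => f.coeff k) k
      rw [this, if_pos hk]
    · lift k to ℕ using hk
      rw [LaurentSeries.coeff_coe_powerSeries, PowerSeries.coeff_mk]
  refine ⟨_, congrArg _ hf, ?_⟩
  have := ramify_coeff d f 0
  simp only [Int.cast_zero, zero_mul] at this
  rw [this, ← PowerSeries.coeff_zero_eq_constantCoeff_apply, PowerSeries.coeff_mk]
  rfl

/-- Substitution `t = x^(1/d)` in power series. -/
def ramifyPowerSeries (d : ℕ+) : PowerSeries ℂ →+* Puiseux :=
  ((ramify d).codRestrict Puiseux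
    fun f => (le_iSup ramifiedField d : ramifiedField d ≤ Puiseux) ⟨f, rfl⟩).comp
    (HahnSeries.ofPowerSeries ℤ ℂ)

theorem exists_forall_coeff_mem_ramifiedField (p : Puiseux[X]) :
    ∃ d : ℕ+, ∀ i, (p.coeff i : HahnSeries ℚ ℂ) ∈ ramifiedField d := by
  have h : ∀ i, ∃ d : ℕ+, (p.coeff i : HahnSeries ℚ ℂ) ∈ ramifiedField d := by
    intro i
    obtain ⟨d, hd⟩ := (mem_puiseux_iff _).1 (p.coeff i).2
    exact ⟨d, (mem_ramifiedField_iff _ _).2 (by simpa only [div_eq_mul_inv] using hd)⟩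
  choose d hd using h
  refine ⟨∏ i ∈ p.support, d i, fun i => ?_⟩
  by_cases hi : i ∈ p.support
  · exact ramifiedField_mono (Finset.dvd_prod_of_mem d hi) (hd i)
  · rw [notMem_support_iff.1 hi]
    exact zero_mem _

/-- A common denominator `d` of all exponents brings the polynomial back to `ℂ⟦t⟧` with `t =
x^(1/d)`, where Weierstrass preparation applies. -/
theorem exists_map_ramifyPowerSeries_eq {p : Puiseux[X]} (hp : p.Monic)
    (h : ∀ i, 0 ≤ nu (p.coeff i)) :
    ∃ (d : ℕ+) (Q : (PowerSeries ℂ)[X]), Q.map (ramifyPowerSeries d) = p ∧ Q.Monic ∧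
      Q.natDegree = p.natDegree ∧
      ∀ i, PowerSeries.constantCoeff (Q.coeff i) = (p.coeff i : HahnSeries ℚ ℂ).coeff 0 := by
  obtain ⟨d, hd⟩ := exists_forall_coeff_mem_ramifiedField p
  choose g hg hg' using fun i => exists_powerSeries_of_mem_ramifiedField (hd i) (h i)
  have hgp : ∀ i, ramifyPowerSeries d (g i) = p.coeff i := fun i => Subtype.ext (hg i)
  have hl : p ∈ lifts (ramifyPowerSeries d) := by
    rw [lifts_iff_coeff_lifts]
    exact fun i => ⟨g i, hgp i⟩
  obtain ⟨Q, hQ, hQd, hQm⟩ := lifts_and_degree_eq_and_monic hl hp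
  refine ⟨d, Q, hQ, hQm, natDegree_eq_of_degree_eq hQd, fun i => ?_⟩
  have : Q.coeff i = g i := by
    apply (HahnSeries.ofPowerSeries_injective (Γ := ℤ) (R := ℂ))
    apply (ramify d).injective
    rw [hg, ← hQ, coeff_map]
    rfl
  rw [this, hg']

/-- The monomial `x^σ`. -/
def xpow (σ : ℚ) : Puiseux :=
  ⟨HahnSeries.single σ 1, (mem_puiseux_iff _).2 ⟨⟨σ.den, σ.den_pos⟩, fun q hq => by
    have := HahnSeries.support_single_subset hq
    rw [Set.mem_singleton_iff] at this
    exact ⟨σ.num, by rw [this]; exact (Rat.num_div_den σ).symm⟩⟩⟩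

theorem xpow_mul (σ τ : ℚ) : xpow σ * xpow τ = xpow (σ + τ) :=
  Subtype.ext (by simp [xpow, HahnSeries.single_mul_single])

theorem xpow_zero : xpow 0 = 1 := rfl

theorem nu_mul (a b : Puiseux) : nu (a * b) = nu a + nu b :=
  HahnSeries.orderTop_mul _ _

theorem nu_xpow_pow (σ : ℚ) (k : ℕ) : nu (xpow σ ^ k) = ((k * σ : ℚ) : WithTop ℚ) := by
  simp [nu, xpow, HahnSeries.single_pow, HahnSeries.orderTop_single]

theorem nu_zero : nu 0 = ⊤ := HahnSeries.orderTop_zero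

theorem _root_.Irreducible.natDegree_eq_zero_or_of_dvd {K : Type*} [Field K] {p F : K[X]}
    (hp : Irreducible p) (h : F ∣ p) : F.natDegree = 0 ∨ F.natDegree = p.natDegree := by
  obtain ⟨G, rfl⟩ := h
  have h0 := hp.ne_zero
  rw [natDegree_mul (left_ne_zero_of_mul h0) (right_ne_zero_of_mul h0)]
  rcases hp.isUnit_or_isUnit rfl with h | h
  · exact .inl (natDegree_eq_zero_of_isUnit h)
  · exact .inr (by rw [natDegree_eq_zero_of_isUnit h, add_zero])

instance : CharZero (HahnSeries ℚ ℂ) := charZero_of_injective_ringHom HahnSeries.C_injective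

instance : CharZero (LaurentSeries ℂ) := charZero_of_injective_ringHom HahnSeries.C_injective

instance : CharZero Puiseux := Puiseux.subtype.charZero_iff Puiseux.subtype.injective |>.2 inferInstance

/-- Newton polygon argument: in degree at least two, rescaling the roots makes the polynomial
integral with a reduction other than `X ^ n`, and the factorization lemma then contradicts
irreducibility. -/
theorem natDegree_eq_one_of_irreducible {p : Puiseux[X]} (hm : p.Monic) (hp : Irreducible p)
    (h0 : p.nextCoeff = 0) : p.natDegree = 1 := by
  classical
  by_contra hne
  have hpos := hp.natDegree_pos
  set n := p.natDegree with hn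
  have hlow : ∃ i < n, p.coeff i ≠ 0 := by
    by_contra! h
    have : p = X ^ n := by
      ext1 i
      rw [coeff_X_pow]
      split_ifs with hi
      · rw [hi]; exact hm
      · rcases lt_or_gt_of_ne hi with hi | hi
        · exact h i hi
        · exact coeff_eq_zero_of_natDegree_lt hi
    exact not_irreducible_pow hne (this ▸ hp)
  obtain ⟨i₀, hi₀, hmin⟩ := Finset.exists_min_image ((Finset.range n).filter fun i => p.coeff i ≠ 0)
    (fun i => (p.coeff i : HahnSeries ℚ ℂ).order / ((n : ℚ) - i))
    (by obtain ⟨i, hi, h⟩ := hlow; exact ⟨i, by simp [hi, h]⟩)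
  simp only [Finset.mem_filter, Finset.mem_range] at hi₀ hmin
  -- The least slope: dividing the roots by `x^σ` makes every coefficient integral and gives the
  -- `i₀`-th one valuation exactly `0`.
  set σ : ℚ := (p.coeff i₀ : HahnSeries ℚ ℂ).order / ((n : ℚ) - i₀) with hσ
  set s := p.scaleRoots (xpow (-σ)) with hs
  have hsm : s.Monic := (monic_scaleRoots_iff _).2 hm
  have hsd : s.natDegree = n := natDegree_scaleRoots _ _
  have hsc : ∀ i, i < n → p.coeff i ≠ 0 → nu (s.coeff i) =
      (((p.coeff i : HahnSeries ℚ ℂ).order - ((n : ℚ) - i) * σ : ℚ) : WithTop ℚ) := by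
    intro i hi h
    have h' : (p.coeff i : HahnSeries ℚ ℂ) ≠ 0 := by exact_mod_cast h
    rw [hs, coeff_scaleRoots, nu_mul, nu_xpow_pow, nu, ← HahnSeries.order_eq_orderTop_of_ne_zero h',
      ← hn, ← WithTop.coe_add, Nat.cast_sub hi.le]
    congr 1
    ring
  have hs0 : ∀ i, 0 ≤ nu (s.coeff i) := by
    intro i
    rcases lt_trichotomy i n with hi | hi | hi
    · by_cases h : p.coeff i = 0
      · rw [hs, coeff_scaleRoots, h, zero_mul, nu_zero]; exact le_top
      · rw [hsc i hi h]
        have h1 := hmin i ⟨hi, h⟩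
        have h2 : (0 : ℚ) < n - i := sub_pos.2 (by exact_mod_cast hi)
        rw [le_div_iff₀ h2] at h1
        have : 0 ≤ (p.coeff i : HahnSeries ℚ ℂ).order - ((n : ℚ) - i) * σ := by linarith
        exact_mod_cast this
    · rw [hi, ← hsd, hsm.coeff_natDegree]
      exact HahnSeries.orderTop_one.ge
    · rw [coeff_eq_zero_of_natDegree_lt (by rwa [hsd]), nu_zero]; exact le_top
  have hsi₀ : (s.coeff i₀ : HahnSeries ℚ ℂ).coeff 0 ≠ 0 := by
    apply HahnSeries.coeff_orderTop_ne
    change nu (s.coeff i₀) = _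
    rw [hsc i₀ hi₀.1 hi₀.2]
    have h2 : (n : ℚ) - i₀ ≠ 0 := sub_ne_zero.2 (by exact_mod_cast hi₀.1.ne')
    rw [hσ, mul_div_cancel₀ _ h2, sub_self]
  obtain ⟨d, Q, hQ, hQm, hQd, hQc⟩ := exists_map_ramifyPowerSeries_eq hsm hs0
  rw [hsd] at hQd
  have hqd : (Q.map PowerSeries.constantCoeff).natDegree = n := by rw [hQm.natDegree_map, hQd]
  obtain ⟨F, hF, h1, h2, h3⟩ := hQm.exists_factor_of_nextCoeff_eq_zero (by omega) (by
      rw [nextCoeff_of_natDegree_pos (by omega), hqd, coeff_map, hQc, hs, coeff_scaleRoots,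
        ← nextCoeff_of_natDegree_pos (p := p) hpos, h0, zero_mul]
      rfl) (by
      intro h
      have := congrArg (fun q => q.coeff i₀) h
      simp only [coeff_map, hQc, coeff_X_pow, hQd, if_neg hi₀.1.ne] at this
      exact hsi₀ this)
  have hdvd : (F.map (ramifyPowerSeries d)).scaleRoots (xpow σ) ∣ p := by
    have := scaleRoots_dvd (r := xpow σ) _ _ (Polynomial.map_dvd (ramifyPowerSeries d) h3)
    rwa [hQ, hs, ← scaleRoots_mul, xpow_mul, neg_add_cancel, xpow_zero, scaleRoots_one] at this
  have := hp.natDegree_eq_zero_or_of_dvd hdvd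
  rw [natDegree_scaleRoots, hF.natDegree_map] at this
  omega

/-- **Newton–Puiseux theorem**. -/
instance : IsAlgClosed Puiseux := by
  refine IsAlgClosed.of_exists_root _ fun p hm hp => ?_
  have hn : (p.natDegree : Puiseux) ≠ 0 := by
    exact_mod_cast hp.natDegree_pos.ne'
  -- Tschirnhaus translation: it kills the next-to-leading coefficient and preserves irreducibility.
  have h1 : (taylor (-p.nextCoeff / p.natDegree) p).natDegree = 1 := by
    refine natDegree_eq_one_of_irreducible ?_ ?_ ?_
    · rw [Monic, leadingCoeff_taylor]; exact hm
    · exact (MulEquiv.irreducible_iff (taylorEquiv (-p.nextCoeff / p.natDegree))).2 hp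
    · rw [hm.nextCoeff_taylor]; field_simp; ring
  rw [natDegree_taylor] at h1
  obtain ⟨x, hx⟩ := exists_root_of_degree_eq_one (p := p)
    (by rw [degree_eq_natDegree hm.ne_zero, h1]; rfl)
  exact ⟨x, hx⟩

/-! ### The Euler derivation and logarithmic derivatives -/

section HahnSeries

open HahnSeries

theorem lt_orderTop_of_forall_coeff {y : HahnSeries ℚ ℂ} {r : ℚ} (h : ∀ i ≤ r, y.coeff i = 0) :
    (r : WithTop ℚ) < y.orderTop := by
  by_contra! hle
  obtain ⟨g, hg⟩ := WithTop.ne_top_iff_exists.1 (hle.trans_lt (WithTop.coe_lt_top r)).ne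
  rw [← hg] at hle
  exact coeff_orderTop_ne hg.symm (h g (by exact_mod_cast hle))

theorem le_orderTop_of_forall_coeff {y : HahnSeries ℚ ℂ} {v : WithTop ℚ}
    (h : ∀ i : ℚ, (i : WithTop ℚ) < v → y.coeff i = 0) : v ≤ y.orderTop := by
  by_contra! hlt
  obtain ⟨g, hg⟩ := WithTop.ne_top_iff_exists.1 (hlt.trans_le le_top).ne
  exact coeff_orderTop_ne hg.symm (h g (by rwa [hg]))

/-- Here `r` is only a lower bound for the order of `y`; if it is strict, both sides vanish. -/
theorem coeff_mul_of_le_orderTop {y z : HahnSeries ℚ ℂ} {r : ℚ} (hy : (r : WithTop ℚ) ≤ y.orderTop)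
    (hz : 0 ≤ z.orderTop) : (y * z).coeff r = y.coeff r * z.coeff 0 := by
  set y' := y - single r (y.coeff r) with hy'
  have h : (r : WithTop ℚ) < y'.orderTop := by
    refine lt_orderTop_of_forall_coeff fun i hi => ?_
    rcases hi.lt_or_eq with hi | rfl
    · rw [hy', HahnSeries.coeff_sub, coeff_single_of_ne hi.ne, sub_zero]
      exact coeff_eq_zero_of_lt_orderTop (lt_of_lt_of_le (by exact_mod_cast hi) hy)
    · simp [hy']
  have h2 : (y' * z).coeff r = 0 := by
    apply coeff_eq_zero_of_lt_orderTop
    rw [orderTop_mul]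
    exact lt_of_lt_of_le h (le_add_of_nonneg_right hz)
  have h3 : y = single r (y.coeff r) + y' := by rw [hy']; ring
  conv_lhs => rw [h3]
  rw [add_mul, HahnSeries.coeff_add, h2, add_zero, coeff_single_mul, sub_self]

/-- The derivation `x d/dx` on `ℂ⟦x^ℚ⟧`. -/
def eulerDerivation : HahnSeries ℚ ℂ →+ HahnSeries ℚ ℂ where
  toFun y := ⟨fun q => q * y.coeff q, y.isPWO_support.mono fun q hq => by
    rw [Function.mem_support] at hq
    exact right_ne_zero_of_mul hq⟩
  map_zero' := by ext q; simp
  map_add' y z := by ext q; simp [mul_add]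

theorem coeff_eulerDerivation (y : HahnSeries ℚ ℂ) (q : ℚ) :
    (eulerDerivation y).coeff q = q * y.coeff q := rfl

theorem eulerDerivation_mul (y z : HahnSeries ℚ ℂ) :
    eulerDerivation (y * z) = y * eulerDerivation z + eulerDerivation y * z := by
  have hs : ∀ y, (eulerDerivation y).support ⊆ y.support := fun y q hq => right_ne_zero_of_mul hq
  ext q
  rw [HahnSeries.coeff_add, coeff_mul_right' z.isPWO_support (hs z),
    coeff_mul_left' y.isPWO_support (hs y), ← Finset.sum_add_distrib, coeff_eulerDerivation,
    HahnSeries.coeff_mul, Finset.mul_sum]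
  refine Finset.sum_congr rfl fun ij hij => ?_
  have : ij.1 + ij.2 = q := (Finset.mem_antidiagonal.1 hij).2.2
  rw [← this, coeff_eulerDerivation, coeff_eulerDerivation]
  push_cast
  ring

theorem eulerDerivation_one : eulerDerivation 1 = 0 := by
  have h := eulerDerivation_mul 1 1
  rw [mul_one, mul_one, one_mul] at h
  simpa using h

theorem eulerDerivation_pow (y : HahnSeries ℚ ℂ) (n : ℕ) :
    eulerDerivation (y ^ n) = n * y ^ (n - 1) * eulerDerivation y := by
  induction n with
  | zero => simp [eulerDerivation_one]
  | succ n ih =>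
    rw [pow_succ, eulerDerivation_mul, ih]
    cases n with
    | zero => simp
    | succ m => simp only [Nat.add_sub_cancel, pow_succ]; push_cast; ring

theorem orderTop_le_orderTop_eulerDerivation (y : HahnSeries ℚ ℂ) :
    y.orderTop ≤ (eulerDerivation y).orderTop :=
  le_orderTop_of_forall_coeff fun i hi => by
    rw [coeff_eulerDerivation, coeff_eq_zero_of_lt_orderTop hi, mul_zero]

/-- Unlike `d/dx`, the operator `x d/dx` never lowers the valuation. -/
theorem orderTop_logDeriv_nonneg {y : HahnSeries ℚ ℂ} (hy : y ≠ 0) :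
    0 ≤ (eulerDerivation y / y).orderTop := by
  have h := orderTop_le_orderTop_eulerDerivation y
  rw [← div_mul_cancel₀ (eulerDerivation y) hy] at h
  rw [orderTop_mul, ← order_eq_orderTop_of_ne_zero hy] at h
  cases h' : (eulerDerivation y / y).orderTop with
  | top => exact le_top
  | coe g =>
    rw [h'] at h
    have h : y.order ≤ g + y.order := by exact_mod_cast h
    have : 0 ≤ g := by linarith
    exact_mod_cast this

/-- `x d/dx` multiplies the leading coefficient of `y` by the order of `y`. -/
theorem coeff_zero_logDeriv {y : HahnSeries ℚ ℂ} (hy : y ≠ 0) :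
    (eulerDerivation y / y).coeff 0 = y.order := by
  have h := coeff_mul_of_le_orderTop (order_eq_orderTop_of_ne_zero hy).le
    (orderTop_logDeriv_nonneg hy)
  rw [mul_div_cancel₀ _ hy, coeff_eulerDerivation, mul_comm] at h
  exact (mul_left_cancel₀ (coeff_orderTop_ne (order_eq_orderTop_of_ne_zero hy).symm) h).symm

end HahnSeries

/-! ### The maximum principle and the lower bound for `u` -/

/-- Maximum principle: at an index where `c` is largest, the sum has only nonnegative terms, so each
vanishes. No symmetry of `q` is needed. -/
theorem eq_of_sum_mul_sub_eq_zero {ι : Type*} [DecidableEq ι] {s : Finset ι} {c : ι → ℝ}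
    {q : ι → ι → ℝ} (hq : ∀ i ∈ s, ∀ j ∈ s, i ≠ j → 0 < q i j)
    (h : ∀ k ∈ s, ∑ j ∈ s.erase k, q k j * (c k - c j) = 0) :
    ∀ i ∈ s, ∀ j ∈ s, c i = c j := by
  rcases s.eq_empty_or_nonempty with rfl | hs
  · simp
  obtain ⟨k, hk, hmax⟩ := s.exists_max_image c hs
  have key : ∀ j ∈ s, c j = c k := by
    intro j hj
    by_cases hjk : j = k
    · rw [hjk]
    have hpos : ∀ i ∈ s.erase k, 0 ≤ q k i * (c k - c i) := fun i hi =>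
      mul_nonneg (hq k hk i (Finset.mem_of_mem_erase hi) (Finset.ne_of_mem_erase hi).symm).le
        (sub_nonneg.2 (hmax i (Finset.mem_of_mem_erase hi)))
    have h0 := (Finset.sum_eq_zero_iff_of_nonneg hpos).1 (h k hk) j
      (Finset.mem_erase.2 ⟨hjk, hj⟩)
    rcases mul_eq_zero.1 h0 with h1 | h1
    · exact absurd h1 (hq k hk j hj (Ne.symm hjk)).ne'
    · linarith
  intro i hi j hj
  rw [key i hi, key j hj]

theorem eq_of_sum_mul_sub_eq_zero_complex {ι : Type*} [DecidableEq ι] {s : Finset ι} {c : ι → ℂ}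
    {q : ι → ι → ℝ} (hq : ∀ i ∈ s, ∀ j ∈ s, i ≠ j → 0 < q i j)
    (h : ∀ k ∈ s, ∑ j ∈ s.erase k, (q k j : ℂ) * (c k - c j) = 0) :
    ∀ i ∈ s, ∀ j ∈ s, c i = c j := by
  intro i hi j hj
  apply Complex.ext
  · refine eq_of_sum_mul_sub_eq_zero (c := fun i => (c i).re) hq (fun k hk => ?_) i hi j hj
    have := congrArg Complex.re (h k hk)
    simpa [Complex.re_sum] using this
  · refine eq_of_sum_mul_sub_eq_zero (c := fun i => (c i).im) hq (fun k hk => ?_) i hi j hj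
    have := congrArg Complex.im (h k hk)
    simpa [Complex.im_sum] using this

/-- If the least order `ρ` of the `U i` were below `r`, the coefficients of `x^ρ` in the hypotheses
`hW` would form the system of the maximum principle with weights `ord (a k - a j)`. All leading
coefficients then agree, and `hU` makes them zero. -/
theorem le_orderTop_of_sum_logDeriv {ι : Type*} [DecidableEq ι] {s : Finset ι}
    {a U : ι → HahnSeries ℚ ℂ} (ha : Set.InjOn a s) (hpos : ∀ i ∈ s, 0 < (a i).orderTop)
    (hU : ∑ i ∈ s, U i = 0) {r : ℚ}
    (hW : ∀ k ∈ s, (r : WithTop ℚ) ≤ (∑ j ∈ s.erase k,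
      (U k - U j) * (eulerDerivation (a k - a j) / (a k - a j))).orderTop) :
    ∀ k ∈ s, (r : WithTop ℚ) ≤ (U k).orderTop := by
  by_contra! hcon
  obtain ⟨k₁, hk₁, hlt⟩ := hcon
  obtain ⟨k₀, hk₀, hmin⟩ := s.exists_min_image (fun i => (U i).orderTop) ⟨k₁, hk₁⟩
  have hlt0 : (U k₀).orderTop < r := (hmin k₁ hk₁).trans_lt hlt
  obtain ⟨ρ, hρ⟩ := WithTop.ne_top_iff_exists.1 (hlt0.trans_le le_top).ne
  have hne : ∀ i ∈ s, ∀ j ∈ s, i ≠ j → a i - a j ≠ 0 := fun i hi j hj hij =>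
    sub_ne_zero.2 fun h => hij (ha hi hj h)
  have hconst : ∀ i ∈ s, ∀ j ∈ s, (U i).coeff ρ = (U j).coeff ρ := by
    refine eq_of_sum_mul_sub_eq_zero_complex (q := fun i j => ((a i - a j).order : ℝ)) ?_ ?_
    · intro i hi j hj hij
      have h1 : 0 < (a i - a j).orderTop := by
        have := (HahnSeries.addVal ℚ ℂ).map_sub (a i) (a j)
        simp only [HahnSeries.addVal_apply] at this
        exact lt_of_lt_of_le (lt_min (hpos i hi) (hpos j hj)) this
      have := (HahnSeries.zero_lt_orderTop_iff (hne i hi j hj hij)).1 h1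
      exact_mod_cast this
    · intro k hk
      have h1 := HahnSeries.coeff_eq_zero_of_lt_orderTop
        (lt_of_lt_of_le (hρ ▸ hlt0 : (ρ : WithTop ℚ) < r) (hW k hk))
      rw [HahnSeries.coeff_sum] at h1
      rw [← h1]
      refine Finset.sum_congr rfl fun j hj => ?_
      have hj' := Finset.mem_of_mem_erase hj
      have hd := hne k hk j hj' (Finset.ne_of_mem_erase hj).symm
      rw [coeff_mul_of_le_orderTop _ (orderTop_logDeriv_nonneg hd), coeff_zero_logDeriv hd,
        HahnSeries.coeff_sub, mul_comm]
      · simp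
      · have := (HahnSeries.addVal ℚ ℂ).map_sub (U k) (U j)
        simp only [HahnSeries.addVal_apply] at this
        rw [hρ]
        exact (le_min (hmin k hk) (hmin j hj')).trans this
  have hsum := congrArg (fun y => HahnSeries.coeff y ρ) hU
  simp only [HahnSeries.coeff_sum, HahnSeries.coeff_zero] at hsum
  rw [Finset.sum_congr rfl fun i hi => hconst i hi k₀ hk₀, Finset.sum_const, smul_eq_zero] at hsum
  rcases hsum with h | h
  · exact (Finset.card_ne_zero_of_mem hk₀) h
  · exact HahnSeries.coeff_orderTop_ne hρ.symm h

/-! ### Lagrange coordinates and the division identity -/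

section Lagrange

open Lagrange

variable {k ι : Type*} [Field k] [DecidableEq ι] {s : Finset ι} {a : ι → k}

theorem derivative_nodal_eval_ne_zero (ha : Set.InjOn a s) {i : ι} (hi : i ∈ s) :
    (derivative (nodal s a)).eval (a i) ≠ 0 := by
  rw [eval_nodal_derivative_eval_node_eq hi, eval_nodal, Finset.prod_ne_zero_iff]
  intro j hj
  exact sub_ne_zero.2 fun h => (Finset.ne_of_mem_erase hj)
    (ha hi (Finset.mem_of_mem_erase hj) h).symm

theorem eq_sum_nodal_erase (ha : Set.InjOn a s) {g : k[X]} (hg : g.degree < s.card) :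
    g = ∑ i ∈ s, C (g.eval (a i) / (derivative (nodal s a)).eval (a i)) * nodal (s.erase i) a := by
  refine eq_of_degrees_lt_of_eval_index_eq s ha hg ?_ fun i hi => ?_
  · refine (degree_sum_le _ _).trans_lt ?_
    rw [Finset.sup_lt_iff (WithBot.bot_lt_coe _)]
    intro i hi
    refine ((degree_mul_le _ _).trans (add_le_of_nonpos_left degree_C_le)).trans_lt ?_
    rw [degree_nodal, Finset.card_erase_of_mem hi]
    exact_mod_cast Nat.sub_lt (Finset.card_pos.2 ⟨i, hi⟩) one_pos
  · rw [eval_finsetSum, Finset.sum_eq_single_of_mem i hi]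
    · rw [eval_mul, eval_C, ← eval_nodal_derivative_eval_node_eq hi,
        div_mul_cancel₀ _ (derivative_nodal_eval_ne_zero ha hi)]
    · intro j _ hji
      rw [eval_mul, eval_nodal_at_node (Finset.mem_erase.2 ⟨hji.symm, hi⟩), mul_zero]

/-- Each basis element is monic of degree `s.card - 1`, so the sum of the coordinates is the
coefficient of `g` in that degree. -/
theorem sum_div_derivative_nodal_eval (ha : Set.InjOn a s) {g : k[X]}
    (hg : g.degree < (s.card - 1 : ℕ)) :
    ∑ i ∈ s, g.eval (a i) / (derivative (nodal s a)).eval (a i) = 0 := by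
  have h := congrArg (fun p => p.coeff (s.card - 1)) (eq_sum_nodal_erase ha
    (hg.trans_le (by exact_mod_cast Nat.sub_le _ _)))
  simp only [coeff_eq_zero_of_degree_lt hg, finsetSum_coeff, coeff_C_mul] at h
  rw [h]
  refine Finset.sum_congr rfl fun i hi => ?_
  have : (nodal (s.erase i) a).coeff (s.card - 1) = 1 := by
    have h1 := (nodal_monic (s := s.erase i) (v := a)).coeff_natDegree
    rwa [natDegree_nodal, Finset.card_erase_of_mem hi] at h1
  rw [this, mul_one]

/-- In the application `g` is `f'_x` and `b i` is the derivative of the root `a i`. The right-hand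
side depends only on differences of coordinates of `u`, which is what the maximum principle needs.
-/
theorem eval_eq_of_mul_nodal_eq (ha : Set.InjOn a s) {b : ι → k} {g u v w : k[X]}
    (hg : g.degree < s.card) (hu : u.degree < s.card) (hv : v.degree < s.card)
    (hgb : ∀ i ∈ s, g.eval (a i) = -((derivative (nodal s a)).eval (a i) * b i))
    (h : w * nodal s a = u * g + v * derivative (nodal s a)) {l : ι} (hl : l ∈ s) :
    w.eval (a l) / (derivative (nodal s a)).eval (a l) = ∑ j ∈ s.erase l,
      (u.eval (a l) / (derivative (nodal s a)).eval (a l) -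
        u.eval (a j) / (derivative (nodal s a)).eval (a j)) * ((b l - b j) / (a l - a j)) := by
  set D := derivative (nodal s a) with hD
  have hD0 : ∀ i ∈ s, D.eval (a i) ≠ 0 := fun i hi => derivative_nodal_eval_ne_zero ha hi
  set ε : ι → k[X] := fun i => nodal (s.erase i) a with hε
  set c : ι → k := fun i => u.eval (a i) / D.eval (a i) with hc
  have eu : u = ∑ i ∈ s, C (c i) * ε i := eq_sum_nodal_erase ha hu
  have eg : g = ∑ i ∈ s, C (-b i) * ε i := by
    conv_lhs => rw [eq_sum_nodal_erase ha hg]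
    refine Finset.sum_congr rfl fun i hi => ?_
    rw [hgb i hi, neg_div, mul_div_cancel_left₀ _ (hD0 i hi)]
  -- At a root the left side of `h` vanishes, so `v` takes the value `u(a_i) b_i` there.
  have ev : v = ∑ i ∈ s, C (c i * b i) * ε i := by
    conv_lhs => rw [eq_sum_nodal_erase ha hv]
    refine Finset.sum_congr rfl fun i hi => ?_
    have h1 := congrArg (eval (a i)) h
    rw [eval_mul, eval_nodal_at_node hi, mul_zero, eval_add, eval_mul, eval_mul, hgb i hi] at h1
    have h2 : v.eval (a i) = u.eval (a i) * b i := by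
      apply mul_right_cancel₀ (hD0 i hi)
      linear_combination -h1
    rw [h2, hc]
    congr 2
    ring
  have eD : D = ∑ i ∈ s, ε i := by
    rw [hD, derivative_nodal]
  -- The diagonal terms of the double sum cancel, and for `i ≠ j` the product `ε i * ε j` is
  -- divisible by the nodal polynomial, which can be cancelled.
  have hw : w = ∑ i ∈ s, ∑ j ∈ s.erase i,
      C (c i * (b i - b j)) * nodal ((s.erase i).erase j) a := by
    apply mul_right_cancel₀ (nodal_ne_zero (s := s) (v := a))
    rw [h]
    conv_lhs => rw [eu, eg, ev, eD]
    rw [Finset.sum_mul_sum, Finset.sum_mul_sum, ← Finset.sum_add_distrib, Finset.sum_mul]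
    refine Finset.sum_congr rfl fun i hi => ?_
    rw [← Finset.sum_add_distrib, Finset.sum_mul, ← Finset.add_sum_erase _ _ hi]
    have h0 : C (c i) * ε i * (C (-b i) * ε i) + C (c i * b i) * ε i * ε i = 0 := by
      simp only [C_mul, C_neg]; ring
    rw [h0, zero_add]
    refine Finset.sum_congr rfl fun j hj => ?_
    have h1 : nodal s a = (X - C (a i)) * ε i := nodal_eq_mul_nodal_erase hi
    have h2 : ε i = (X - C (a j)) * nodal ((s.erase i).erase j) a := nodal_eq_mul_nodal_erase hj
    have h3 : ε j = (X - C (a i)) * nodal ((s.erase i).erase j) a := by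
      rw [Finset.erase_right_comm]
      exact nodal_eq_mul_nodal_erase (Finset.mem_erase.2 ⟨(Finset.ne_of_mem_erase hj).symm, hi⟩)
    rw [h1, h3, h2]
    simp only [C_mul, C_neg, C_sub]
    ring
  have hzero : ∀ i j, i ≠ l → j ≠ l → (nodal ((s.erase i).erase j) a).eval (a l) = 0 :=
    fun i j hi hj => eval_nodal_at_node (Finset.mem_erase.2 ⟨hj.symm,
      Finset.mem_erase.2 ⟨hi.symm, hl⟩⟩)
  rw [div_eq_iff (hD0 l hl), Finset.sum_mul]
  conv_lhs => rw [hw]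
  simp only [eval_finsetSum, eval_mul, eval_C]
  rw [← Finset.add_sum_erase _ _ hl]
  -- At `a l` only the pairs containing `l` survive; `(l, j)` and `(j, l)` combine into the factor
  -- `c l - c j`.
  have h4 : ∀ i ∈ s.erase l, ∑ j ∈ s.erase i, c i * (b i - b j) *
      (nodal ((s.erase i).erase j) a).eval (a l) =
      c i * (b i - b l) * (nodal ((s.erase i).erase l) a).eval (a l) := by
    intro i hi
    refine Finset.sum_eq_single_of_mem l (Finset.mem_erase.2 ⟨(Finset.ne_of_mem_erase hi).symm, hl⟩)
      fun j _ hjl => ?_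
    rw [hzero i j (Finset.ne_of_mem_erase hi) hjl, mul_zero]
  rw [Finset.sum_congr rfl h4, ← Finset.sum_add_distrib]
  refine Finset.sum_congr rfl fun j hj => ?_
  have h5 : D.eval (a l) = (a l - a j) * (nodal ((s.erase l).erase j) a).eval (a l) := by
    rw [hD, eval_nodal_derivative_eval_node_eq hl, nodal_eq_mul_nodal_erase hj]
    simp
  have h6 : a l - a j ≠ 0 := sub_ne_zero.2 fun h => (Finset.ne_of_mem_erase hj)
    (ha hl (Finset.mem_of_mem_erase hj) h).symm
  rw [Finset.erase_right_comm (a := j)]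
  change _ = (c l - c j) * _ * _
  rw [h5]
  field_simp
  ring

end Lagrange

/-! ### Squarefreeness over `K`, and the chain rule for power series coefficients -/

/-- Gauss's lemma: over an integrally closed domain a factor of `f` over `K` is, up to a constant, a
monic polynomial over `R`, so a square factor descends. -/
theorem _root_.Polynomial.Monic.squarefree_map_fractionRing {R K : Type*} [CommRing R] [IsDomain R]
    [IsIntegrallyClosed R] [Field K] [Algebra R K] [IsFractionRing R K] {f : R[X]} (hf : f.Monic)
    (hs : Squarefree f) : Squarefree (f.map (algebraMap R K)) := by
  intro g hg
  have hg0 : g ≠ 0 := by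
    rintro rfl
    rw [zero_mul, zero_dvd_iff] at hg
    exact (hf.map _).ne_zero hg
  obtain ⟨g', hg'⟩ := IsIntegrallyClosed.eq_map_mul_C_of_dvd K hf (dvd_of_mul_left_dvd hg)
  have hlc : g.leadingCoeff ≠ 0 := leadingCoeff_ne_zero.2 hg0
  have hu : IsUnit (C g.leadingCoeff) := isUnit_C.2 hlc.isUnit
  have hmon : g'.Monic := by
    have h := congrArg leadingCoeff hg'
    rw [leadingCoeff_mul, leadingCoeff_C, mul_eq_right₀ hlc,
      leadingCoeff_map_of_injective (IsFractionRing.injective R K)] at h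
    exact IsFractionRing.injective R K (by rw [h, map_one])
  have hdvd : (g' * g').map (algebraMap R K) ∣ f.map (algebraMap R K) := by
    rw [Polynomial.map_mul]
    exact (mul_dvd_mul (Dvd.intro _ hg') (Dvd.intro _ hg')).trans hg
  have h1 := hs g' (Monic.dvd_of_fraction_map_dvd_fraction_map hf (hmon.mul hmon) hdvd)
  rw [← hg']
  exact (h1.map (mapRingHom (algebraMap R K))).mul hu

/-- The inclusion `ℂ⟦x⟧ → ℂ⟦x^ℚ⟧`. -/
def toHahn : PowerSeries ℂ →+* HahnSeries ℚ ℂ :=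
  (ramify 1).comp (algebraMap (PowerSeries ℂ) (LaurentSeries ℂ))

theorem toHahn_coeff (c : PowerSeries ℂ) (n : ℕ) :
    (toHahn c).coeff n = PowerSeries.coeff n c := by
  have := ramify_coeff 1 (algebraMap (PowerSeries ℂ) (LaurentSeries ℂ) c) n
  simp only [Int.cast_natCast, PNat.val_ofNat, Nat.cast_one, inv_one, mul_one] at this
  exact this.trans (LaurentSeries.coeff_coe_powerSeries c n)

theorem toHahn_coeff_of_notMem (c : PowerSeries ℂ) (q : ℚ) (hq : ∀ n : ℕ, q ≠ n) :
    (toHahn c).coeff q = 0 := by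
  by_cases h : ∃ k : ℤ, q = k
  · obtain ⟨k, rfl⟩ := h
    have := ramify_coeff 1 (algebraMap (PowerSeries ℂ) (LaurentSeries ℂ) c) k
    simp only [PNat.val_ofNat, Nat.cast_one, inv_one, mul_one] at this
    refine this.trans ((PowerSeries.coeff_coe (f := c) k).trans ?_)
    rw [if_pos]
    by_contra! hk
    lift k to ℕ using hk
    exact hq k (by simp)
  · push Not at h
    exact ramify_coeff_of_notMem _ _ _ (by simpa using h)

theorem orderTop_toHahn_nonneg (c : PowerSeries ℂ) : 0 ≤ (toHahn c).orderTop :=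
  le_orderTop_of_forall_coeff fun i hi => toHahn_coeff_of_notMem c i fun n h => by
    have : i < 0 := by exact_mod_cast hi
    rw [h] at this
    exact absurd this (not_lt.2 (Nat.cast_nonneg n))

theorem orderTop_toHahn_pos {c : PowerSeries ℂ} (hc : PowerSeries.constantCoeff c = 0) :
    0 < (toHahn c).orderTop := by
  refine lt_orderTop_of_forall_coeff fun i hi => ?_
  rcases hi.lt_or_eq with hi | rfl
  · exact HahnSeries.coeff_eq_zero_of_lt_orderTop
      (lt_of_lt_of_le (by exact_mod_cast hi) (orderTop_toHahn_nonneg c))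
  · have := toHahn_coeff c 0
    rw [Nat.cast_zero] at this
    rw [this, PowerSeries.coeff_zero_eq_constantCoeff_apply, hc]

theorem eulerDerivation_toHahn (c : PowerSeries ℂ) :
    eulerDerivation (toHahn c) = HahnSeries.single 1 1 * toHahn (PowerSeries.derivative ℂ c) := by
  ext q
  rw [coeff_eulerDerivation, HahnSeries.coeff_single_mul, one_mul]
  by_cases h : ∃ n : ℕ, q = n
  · obtain ⟨n, rfl⟩ := h
    cases n with
    | zero =>
      rw [toHahn_coeff_of_notMem (PowerSeries.derivative ℂ c)]
      · simp
      · intro n h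
        have : (0 : ℚ) ≤ n := Nat.cast_nonneg n
        rw [← h] at this
        norm_num at this
    | succ n =>
      have : ((n + 1 : ℕ) : ℚ) - 1 = n := by push_cast; ring
      rw [this, toHahn_coeff, toHahn_coeff, PowerSeries.coeff_derivative]
      push_cast
      ring
  · push Not at h
    rw [toHahn_coeff_of_notMem c q h, toHahn_coeff_of_notMem, mul_zero]
    intro n hn
    exact h (n + 1) (by push_cast; linarith)

theorem derivX_add (p q : (PowerSeries ℂ)[X]) : derivX (p + q) = derivX p + derivX q := by
  ext1 k
  simp only [coeff_derivX, coeff_add, map_add]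

theorem derivX_monomial (n : ℕ) (c : PowerSeries ℂ) :
    derivX (monomial n c) = monomial n (PowerSeries.derivative ℂ c) := by
  ext1 k
  rw [coeff_derivX, coeff_monomial, coeff_monomial]
  split_ifs <;> simp

/-- Chain rule. At a root of `p` the left side is zero, which expresses `f'_x` there through `f'_y`
and the derivative of the root. -/
theorem eulerDerivation_eval (p : (PowerSeries ℂ)[X]) (a : HahnSeries ℚ ℂ) :
    eulerDerivation ((p.map toHahn).eval a) =
      HahnSeries.single 1 1 * ((derivX p).map toHahn).eval a +
        ((derivY p).map toHahn).eval a * eulerDerivation a := by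
  induction p using Polynomial.induction_on' with
  | add p q hp hq =>
    rw [derivX_add, derivY, derivative_add, Polynomial.map_add, Polynomial.map_add,
      Polynomial.map_add, eval_add, eval_add, eval_add, map_add, hp, hq, derivY, derivY]
    ring
  | monomial n c =>
    rw [derivX_monomial, derivY, derivative_monomial]
    simp only [map_monomial, eval_monomial, eulerDerivation_mul, eulerDerivation_toHahn,
      eulerDerivation_pow, map_mul, map_natCast]
    ring

theorem map_toK (p : (PowerSeries ℂ)[X]) : (toK p).map (ramify 1) = p.map toHahn :=
  Polynomial.map_map _ _ _

theorem coe_eval_toKbar (w : (LaurentSeries ℂ)[X]) (a : Puiseux) :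
    (((toKbar w).eval a : Puiseux) : HahnSeries ℚ ℂ) = (w.map (ramify 1)).eval (a : HahnSeries ℚ ℂ) := by
  change Puiseux.subtype ((w.map toPuiseux).eval a) = _
  rw [← eval_map_apply, Polynomial.map_map]
  rfl

/-! ### The branches of `f` and the valuation estimate -/

section Roots

variable {f : (PowerSeries ℂ)[X]}

theorem map_toHahn_eq_nodal (hm : f.Monic) (hred : Squarefree f) :
    f.map toHahn = Lagrange.nodal (branches f) (Subtype.val : Puiseux → HahnSeries ℚ ℂ) := by
  classical
  have h1 : (toKbar (toK f)).Monic := (hm.map _).map _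
  have h2 : (toKbar (toK f)).Separable :=
    (PerfectField.separable_iff_squarefree.2 (hm.squarefree_map_fractionRing hred)).map
  have h3 := (IsAlgClosed.splits (toKbar (toK f))).eq_prod_roots_of_monic h1
  have h4 : toKbar (toK f) = ∏ a ∈ branches f, (X - C a) := by
    rw [branches, Finset.prod, Multiset.toFinset_val,
      Multiset.dedup_eq_self.2 (nodup_roots h2)]
    exact h3
  have h5 := congrArg (Polynomial.map Puiseux.subtype) h4
  rw [Polynomial.map_prod] at h5
  simp only [Polynomial.map_sub, Polynomial.map_X, Polynomial.map_C] at h5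
  refine Eq.trans ?_ h5
  rw [← map_toK]
  exact (Polynomial.map_map toPuiseux Puiseux.subtype _).symm

theorem card_branches (hm : f.Monic) (hred : Squarefree f) : (branches f).card = f.natDegree := by
  have h := congrArg natDegree (map_toHahn_eq_nodal hm hred)
  rw [hm.natDegree_map, Lagrange.natDegree_nodal] at h
  exact h.symm

theorem map_derivY (hm : f.Monic) (hred : Squarefree f) : (derivY f).map toHahn =
    derivative (Lagrange.nodal (branches f) (Subtype.val : Puiseux → HahnSeries ℚ ℂ)) := by
  rw [derivY, ← derivative_map, map_toHahn_eq_nodal hm hred]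

/-- If `ν(a) ≤ 0`, then `a ^ n` has strictly smaller valuation than every other term of `f(a)`,
since the lower coefficients have positive valuation; so `f(a)` cannot vanish. -/
theorem orderTop_branch_pos (hdist : IsDistinguished f) (hred : Squarefree f)
    {a : Puiseux} (ha : a ∈ branches f) : 0 < (a : HahnSeries ℚ ℂ).orderTop := by
  obtain ⟨hm, h0⟩ := hdist
  by_contra! hle
  obtain ⟨α, hα⟩ := WithTop.ne_top_iff_exists.1 (hle.trans_lt (WithTop.coe_lt_top 0)).ne
  rw [← hα] at hle
  have hα0 : α ≤ 0 := by exact_mod_cast hle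
  set v := HahnSeries.addVal ℚ ℂ
  have hv : v (a : HahnSeries ℚ ℂ) = α := by rw [HahnSeries.addVal_apply, hα]
  have he : (f.map toHahn).eval (a : HahnSeries ℚ ℂ) = 0 := by
    rw [map_toHahn_eq_nodal hm hred]
    exact Lagrange.eval_nodal_at_node ha
  have hpow : ∀ i : ℕ, v ((a : HahnSeries ℚ ℂ) ^ i) = ((i * α : ℚ) : WithTop ℚ) := by
    intro i
    rw [v.map_pow, hv, ← WithTop.coe_nsmul, nsmul_eq_mul]
  rw [eval_eq_sum_range, hm.natDegree_map, Finset.sum_range_succ] at he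
  have hlead : (f.map toHahn).coeff f.natDegree = 1 := by
    rw [coeff_map, hm.coeff_natDegree, map_one]
  rw [hlead, one_mul] at he
  have hlt : ((f.natDegree * α : ℚ) : WithTop ℚ) < v (∑ i ∈ Finset.range f.natDegree,
      (f.map toHahn).coeff i * (a : HahnSeries ℚ ℂ) ^ i) := by
    refine v.map_lt_sum (WithTop.coe_ne_top) fun i hi => ?_
    have hi := Finset.mem_range.1 hi
    have hc : PowerSeries.constantCoeff (f.coeff i) = 0 := by
      rw [← coeff_map, h0, coeff_X_pow, if_neg hi.ne]
    have h1 := orderTop_toHahn_pos hc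
    rw [v.map_mul, hpow, coeff_map, HahnSeries.addVal_apply]
    have h2 : (f.natDegree * α : ℚ) ≤ i * α :=
      mul_le_mul_of_nonpos_right (by exact_mod_cast hi.le) hα0
    cases h3 : (toHahn (f.coeff i)).orderTop with
    | top => exact WithTop.coe_lt_top _
    | coe g =>
      rw [h3] at h1
      have h1 : 0 < g := by exact_mod_cast h1
      have : (f.natDegree * α : ℚ) < g + i * α := by linarith
      exact_mod_cast this
  rw [eq_neg_of_add_eq_zero_left he, v.map_neg, hpow] at hlt
  exact lt_irrefl _ hlt

/-- The `a`-th coordinate `w(x, a) / f'_y(x, a)` of `w`. -/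
def coord (f : (PowerSeries ℂ)[X]) (w : (LaurentSeries ℂ)[X]) (a : Puiseux) : HahnSeries ℚ ℂ :=
  (w.map (ramify 1)).eval (a : HahnSeries ℚ ℂ) /
    ((derivY f).map toHahn).eval (a : HahnSeries ℚ ℂ)

theorem nu_eq_orderTop_coord (w : (LaurentSeries ℂ)[X]) (a : Puiseux) :
    nu ((toKbar w).eval a / (toKbar (toK (derivY f))).eval a) = (coord f w a).orderTop := by
  rw [nu, coord, ← coe_eval_toKbar, ← map_toK, ← coe_eval_toKbar]
  rfl

theorem le_val_iff {w : (LaurentSeries ℂ)[X]} {r : ℚ} : (r : WithTop ℚ) ≤ val f (toKbar w) ↔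
    ∀ a ∈ branches f, (r : WithTop ℚ) ≤ (coord f w a).orderTop := by
  simp only [val, Finset.le_inf_iff, nu_eq_orderTop_coord]

theorem lt_val_iff {w : (LaurentSeries ℂ)[X]} {r : ℚ} : (r : WithTop ℚ) < val f (toKbar w) ↔
    ∀ a ∈ branches f, (r : WithTop ℚ) < (coord f w a).orderTop := by
  simp only [val, Finset.lt_inf_iff (WithTop.coe_lt_top r), nu_eq_orderTop_coord]

theorem degree_derivX_lt (hm : f.Monic) : (derivX f).degree < f.natDegree := by
  rw [degree_lt_iff_coeff_zero]
  intro k hk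
  rw [coeff_derivX]
  rcases hk.lt_or_eq with h | rfl
  · rw [coeff_eq_zero_of_natDegree_lt h, map_zero]
  · rw [hm.coeff_natDegree]; exact Derivation.map_one_eq_zero _

theorem coe_injOn_branches :
    Set.InjOn (Subtype.val : Puiseux → HahnSeries ℚ ℂ) (branches f) :=
  Subtype.val_injective.injOn

/-- If `w f = u f'_x + v f'_y` then `val u ≥ val w + 1` and `val v > val w`. -/
theorem le_val_and_lt_val_of_mul_eq (hdist : IsDistinguished f) (hred : Squarefree f)
    {r : ℚ} {u v w : (LaurentSeries ℂ)[X]}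
    (hu : u ∈ degreeLT (LaurentSeries ℂ) (f.natDegree - 1))
    (hv : v ∈ degreeLT (LaurentSeries ℂ) f.natDegree)
    (h : w * toK f = u * toK (derivX f) + v * toK (derivY f))
    (hw : (r : WithTop ℚ) ≤ val f (toKbar w)) :
    ((r + 1 : ℚ) : WithTop ℚ) ≤ val f (toKbar u) ∧ (r : WithTop ℚ) < val f (toKbar v) := by
  classical
  have hm := hdist.1
  set S := branches f
  have hcard : S.card = f.natDegree := card_branches hm hred
  set x : HahnSeries ℚ ℂ := HahnSeries.single 1 1 with hx
  have hx0 : x ≠ 0 := HahnSeries.single_ne_zero one_ne_zero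
  have hxo : x.orderTop = ((1 : ℚ) : WithTop ℚ) := HahnSeries.orderTop_single one_ne_zero
  set N := Lagrange.nodal S (Subtype.val : Puiseux → HahnSeries ℚ ℂ) with hN
  have hD : (derivY f).map toHahn = derivative N := map_derivY hm hred
  have hD0 : ∀ a ∈ S, (derivative N).eval (a : HahnSeries ℚ ℂ) ≠ 0 := fun a ha =>
    derivative_nodal_eval_ne_zero coe_injOn_branches ha
  have hgx : ∀ a ∈ S, x * ((derivX f).map toHahn).eval (a : HahnSeries ℚ ℂ) =
      -((derivative N).eval (a : HahnSeries ℚ ℂ) * eulerDerivation (a : HahnSeries ℚ ℂ)) := by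
    intro a ha
    have h1 := eulerDerivation_eval f (a : HahnSeries ℚ ℂ)
    rw [map_toHahn_eq_nodal hm hred, Lagrange.eval_nodal_at_node ha, map_zero, hD] at h1
    exact eq_neg_of_add_eq_zero_left h1.symm
  have h' := congrArg (Polynomial.map (ramify 1)) h
  simp only [Polynomial.map_mul, Polynomial.map_add, map_toK, hD] at h'
  rw [map_toHahn_eq_nodal hm hred] at h'
  have hu' : (u.map (ramify 1)).degree < (S.card - 1 : ℕ) := by
    rw [hcard, degree_map]; exact mem_degreeLT.1 hu
  have hv' : (v.map (ramify 1)).degree < S.card := by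
    rw [hcard, degree_map]; exact mem_degreeLT.1 hv
  have hlt1 : ((S.card - 1 : ℕ) : WithBot ℕ) ≤ S.card := by exact_mod_cast Nat.sub_le _ _
  have hW : ∀ l ∈ S, x * coord f w l = ∑ j ∈ S.erase l, (coord f u l - coord f u j) *
      (eulerDerivation ((l : HahnSeries ℚ ℂ) - j) / ((l : HahnSeries ℚ ℂ) - j)) := by
    intro l hl
    -- The choice of `b` is `da/dx`, written as `x⁻¹` times the Euler derivative.
    have h1 := eval_eq_of_mul_nodal_eq coe_injOn_branches
      (b := fun a : Puiseux => x⁻¹ * eulerDerivation (a : HahnSeries ℚ ℂ))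
      (g := (derivX f).map toHahn) (s := S)
      (by rw [hcard]; exact degree_map_le.trans_lt (degree_derivX_lt hm))
      (hu'.trans_le hlt1) hv'
      (fun a ha => by
        apply mul_left_cancel₀ hx0
        have e : ∀ A B : HahnSeries ℚ ℂ, -(A * B) = x * -(A * (x⁻¹ * B)) := by
          intro A B; field_simp
        exact (hgx a ha).trans (e _ _)) h' hl
    rw [coord, hD, h1, Finset.mul_sum]
    refine Finset.sum_congr rfl fun j _ => ?_
    rw [coord, coord, hD, map_sub, ← mul_sub, mul_div_assoc, mul_left_comm x,
      mul_inv_cancel_left₀ hx0]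
  -- This is where degree less than `n - 1`, and not merely `n`, is needed for `u`.
  have hU0 : ∑ a ∈ S, coord f u a = 0 := by
    have := sum_div_derivative_nodal_eval (s := S) coe_injOn_branches hu'
    simpa only [coord, hD] using this
  rw [le_val_iff] at hw
  have hu1 : ∀ a ∈ S, ((r + 1 : ℚ) : WithTop ℚ) ≤ (coord f u a).orderTop := by
    refine le_orderTop_of_sum_logDeriv coe_injOn_branches
      (fun a ha => orderTop_branch_pos hdist hred ha) hU0 fun l hl => ?_
    rw [← hW l hl, HahnSeries.orderTop_mul, hxo, add_comm r 1, WithTop.coe_add]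
    exact add_le_add_right (hw l hl) _
  refine ⟨le_val_iff.2 hu1, lt_val_iff.2 fun a ha => ?_⟩
  have hva : x * coord f v a = coord f u a * eulerDerivation (a : HahnSeries ℚ ℂ) := by
    have h1 := congrArg (eval (a : HahnSeries ℚ ℂ)) h'
    rw [eval_mul, Lagrange.eval_nodal_at_node ha, mul_zero, eval_add, eval_mul, eval_mul] at h1
    have h2 := hgx a ha
    rw [coord, coord, hD]
    have h3 := hD0 a ha
    field_simp
    apply mul_right_cancel₀ h3
    linear_combination (-x) * h1 - (u.map (ramify 1)).eval (a : HahnSeries ℚ ℂ) * h2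
  have h1 := congrArg HahnSeries.orderTop hva
  rw [HahnSeries.orderTop_mul, HahnSeries.orderTop_mul, hxo] at h1
  have h2 := (orderTop_branch_pos hdist hred ha).trans_le
    (orderTop_le_orderTop_eulerDerivation (a : HahnSeries ℚ ℂ))
  have h3 := hu1 a ha
  cases hc : (coord f v a).orderTop with
  | top => exact WithTop.coe_lt_top r
  | coe g =>
    rw [hc] at h1
    cases hc1 : (coord f u a).orderTop with
    | top => rw [hc1, top_add] at h1; exact absurd h1 WithTop.coe_ne_top
    | coe g1 =>
      cases hc2 : (eulerDerivation (a : HahnSeries ℚ ℂ)).orderTop with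
      | top => rw [hc2, add_top] at h1; exact absurd h1 WithTop.coe_ne_top
      | coe g2 =>
        rw [hc1, hc2] at h1
        rw [hc1] at h3
        rw [hc2] at h2
        have h1 : 1 + g = g1 + g2 := by exact_mod_cast h1
        have h2 : 0 < g2 := by exact_mod_cast h2
        have h3 : r + 1 ≤ g1 := by exact_mod_cast h3
        have : r < g := by linarith
        exact_mod_cast this

end Roots

/-! ### Existence of the division and membership in the Jacobian ideal -/

theorem toK_injective : Function.Injective toK :=
  map_injective _ (IsFractionRing.injective (PowerSeries ℂ) (LaurentSeries ℂ))

theorem degree_toK (p : (PowerSeries ℂ)[X]) : (toK p).degree = p.degree :=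
  degree_map_eq_of_injective (IsFractionRing.injective (PowerSeries ℂ) (LaurentSeries ℂ)) p

theorem exists_toK_eq {w : (LaurentSeries ℂ)[X]} (h : ∀ i, 0 ≤ (ramify 1 (w.coeff i)).orderTop) :
    ∃ W, toK W = w := by
  suffices w ∈ lifts (algebraMap (PowerSeries ℂ) (LaurentSeries ℂ)) from (mem_lifts _).1 this
  rw [lifts_iff_coeff_lifts]
  intro i
  obtain ⟨g, hg, -⟩ := exists_powerSeries_of_mem_ramifiedField (d := 1)
    (a := ramify 1 (w.coeff i)) ⟨_, rfl⟩ (h i)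
  exact ⟨g, (ramify 1).injective hg⟩

theorem val_zero (f : (PowerSeries ℂ)[X]) : val f 0 = ⊤ := by
  rw [val, ← top_le_iff, Finset.le_inf_iff]
  intro a _
  rw [eval_zero, zero_div, nu_zero]

/-- The integral elements of `ℂ⟦x^ℚ⟧`. -/
def integers : Subring (HahnSeries ℚ ℂ) where
  carrier := {y | 0 ≤ y.orderTop}
  mul_mem' {y z} hy hz := by
    rw [Set.mem_ofPred_eq, HahnSeries.orderTop_mul]
    exact add_nonneg hy hz
  one_mem' := by
    rw [Set.mem_ofPred_eq, HahnSeries.orderTop_one]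
  add_mem' {y z} hy hz := by
    rw [Set.mem_ofPred_eq] at *
    exact (le_min hy hz).trans HahnSeries.min_orderTop_le_orderTop_add
  zero_mem' := by simp
  neg_mem' {y} hy := by simpa using hy

theorem mem_integers {y : HahnSeries ℚ ℂ} : y ∈ integers ↔ 0 ≤ y.orderTop := by
  change y ∈ {y : HahnSeries ℚ ℂ | 0 ≤ y.orderTop} ↔ _
  rw [Set.mem_ofPred_eq]

section

variable {f : (PowerSeries ℂ)[X]}

theorem derivative_bounds (hm : f.Monic) (hn : 2 ≤ f.natDegree) :
    (derivY f).degree < f.natDegree ∧ (derivY f).coeff (f.natDegree - 1) = f.natDegree := by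
  constructor
  · rw [← degree_eq_natDegree hm.ne_zero]
    exact degree_derivative_lt hm.ne_zero
  · rw [derivY, coeff_derivative, Nat.sub_add_cancel (by omega), hm.coeff_natDegree, one_mul]
    have : ((f.natDegree - 1 : ℕ) : PowerSeries ℂ) + 1 = ((f.natDegree - 1 + 1 : ℕ) : PowerSeries ℂ) := by
      push_cast; ring
    rw [this, Nat.sub_add_cancel (by omega)]

theorem degree_mul_lt {R : Type*} [CommRing R] [IsDomain R] {p q : R[X]} {m n : ℕ}
    (hp : p.degree < m) (hq : q.degree < n) : (p * q).degree < (m + n - 1 : ℕ) := by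
  rcases eq_or_ne p 0 with rfl | hp0
  · rw [zero_mul, degree_zero]; exact WithBot.bot_lt_coe _
  rcases eq_or_ne q 0 with rfl | hq0
  · rw [mul_zero, degree_zero]; exact WithBot.bot_lt_coe _
  rw [← natDegree_lt_iff_degree_lt hp0] at hp
  rw [← natDegree_lt_iff_degree_lt hq0] at hq
  rw [← natDegree_lt_iff_degree_lt (mul_ne_zero hp0 hq0), natDegree_mul hp0 hq0]
  omega

/-- The Sylvester map goes between spaces of the same dimension `m + n`, so injectivity gives
surjectivity. -/
theorem exists_eq_mul_add_mul {K : Type*} [Field K] {g h : K[X]} {m n : ℕ} (hg : g.degree ≤ n)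
    (hh : h.degree ≤ m)
    (hinj : ∀ u v, u ∈ degreeLT K m → v ∈ degreeLT K n → u * g + v * h = 0 → u = 0 ∧ v = 0)
    {p : K[X]} (hp : p ∈ degreeLT K (m + n)) :
    ∃ u ∈ degreeLT K m, ∃ v ∈ degreeLT K n, p = u * g + v * h := by
  let Φ : (degreeLT K m × degreeLT K n) →ₗ[K] degreeLT K (m + n) :=
    LinearMap.codRestrict _
      (((LinearMap.mulRight K g).comp ((degreeLT K m).subtype.comp (LinearMap.fst _ _ _))) +
        ((LinearMap.mulRight K h).comp ((degreeLT K n).subtype.comp (LinearMap.snd _ _ _))))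
      (by
        rintro ⟨⟨u, hu⟩, ⟨v, hv⟩⟩
        rw [mem_degreeLT] at hu hv
        have hg' : g.degree < (n + 1 : ℕ) := hg.trans_lt (by exact_mod_cast Nat.lt_succ_self n)
        have hh' : h.degree < (m + 1 : ℕ) := hh.trans_lt (by exact_mod_cast Nat.lt_succ_self m)
        refine Submodule.add_mem _ (mem_degreeLT.2 ?_) (mem_degreeLT.2 ?_)
        · exact (degree_mul_lt hu hg').trans_le (by exact_mod_cast (by omega))
        · exact (degree_mul_lt hv hh').trans_le (by exact_mod_cast (by omega)))
  have hΦ : ∀ z, (Φ z : K[X]) = (z.1 : K[X]) * g + z.2 * h := fun _ => rfl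
  have hker : Function.Injective Φ := by
    rw [injective_iff_map_eq_zero]
    rintro ⟨⟨u, hu⟩, ⟨v, hv⟩⟩ hz
    obtain ⟨rfl, rfl⟩ := hinj u v hu hv (by rw [← hΦ (⟨u, hu⟩, ⟨v, hv⟩), hz]; rfl)
    rfl
  have hsurj : Function.Surjective Φ := by
    rwa [← LinearMap.injective_iff_surjective_of_finrank_eq_finrank]
    rw [Module.finrank_eq_card_basis (degreeLT.basisProd K m n),
      Module.finrank_eq_card_basis (degreeLT.basis K (m + n))]
  obtain ⟨⟨⟨u, hu⟩, ⟨v, hv⟩⟩, hz⟩ := hsurj ⟨p, hp⟩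
  exact ⟨u, hu, v, hv, by rw [← hΦ (⟨u, hu⟩, ⟨v, hv⟩), hz]⟩

/-- Every polynomial of degree less than `2n - 1` is a combination of `f'_x` and `f'_y`. -/
theorem exists_eq_mul_derivX_add_mul_derivY (hdist : IsDistinguished f) (hred : Squarefree f)
    (hn : 2 ≤ f.natDegree) {p : (LaurentSeries ℂ)[X]}
    (hp : p ∈ degreeLT (LaurentSeries ℂ) (f.natDegree - 1 + f.natDegree)) :
    ∃ u ∈ degreeLT (LaurentSeries ℂ) (f.natDegree - 1),
      ∃ v ∈ degreeLT (LaurentSeries ℂ) f.natDegree,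
        p = u * toK (derivX f) + v * toK (derivY f) := by
  set n := f.natDegree with hnd
  have hm := hdist.1
  have hX : (toK (derivX f)).degree < n := by rw [degree_toK]; exact degree_derivX_lt hm
  have hY : (toK (derivY f)).degree < n := by
    rw [degree_toK]; exact (derivative_bounds hm hn).1
  refine exists_eq_mul_add_mul hX.le (degree_le_of_natDegree_le ?_) (fun u v hu hv h0 => ?_) hp
  · refine natDegree_le_of_degree_le (degree_le_iff_coeff_zero _ _ |>.2 fun k hk => ?_)
    have hk : n - 1 < k := by exact_mod_cast hk
    exact coeff_eq_zero_of_degree_lt (hY.trans_le (by exact_mod_cast (by omega)))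
  have hu0 : u = 0 := by
    -- The estimate with `w = 0`, whose `val` is `⊤`, bounds the coordinates of `u` below by every
    -- rational.
    have hall : ∀ r : ℚ, ∀ a ∈ branches f, (r : WithTop ℚ) ≤ (coord f u a).orderTop := by
      intro r
      have := (le_val_and_lt_val_of_mul_eq hdist hred (r := r - 1) (w := 0) hu hv
        (by rw [zero_mul, h0]) (by rw [map_zero, val_zero]; exact le_top)).1
      rw [sub_add_cancel] at this
      exact le_val_iff.1 this
    have hzero : ∀ a ∈ branches f, coord f u a = 0 := by
      intro a ha
      rw [← HahnSeries.orderTop_eq_top]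
      by_contra hne
      obtain ⟨g, hg⟩ := WithTop.ne_top_iff_exists.1 hne
      have := hall (g + 1) a ha
      rw [← hg] at this
      have : g + 1 ≤ g := by exact_mod_cast this
      linarith
    classical
    have hexp := eq_sum_nodal_erase (s := branches f) (g := u.map (ramify 1)) coe_injOn_branches
      (by
        rw [card_branches hm hred, degree_map]
        exact (mem_degreeLT.1 hu).trans_le (by exact_mod_cast Nat.sub_le _ _))
    rw [Finset.sum_eq_zero] at hexp
    · exact (Polynomial.map_eq_zero _).1 hexp
    · intro a ha
      have := hzero a ha
      rw [coord, map_derivY hm hred] at this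
      rw [this, C_0, zero_mul]
  subst hu0
  have hD : toK (derivY f) ≠ 0 := by
    intro h1
    have h2 : derivY f = 0 := toK_injective (by rw [h1, map_zero])
    have h3 := (derivative_bounds hm hn).2
    rw [h2, coeff_zero] at h3
    have : f.natDegree = 0 := by
      have h4 := congrArg PowerSeries.constantCoeff h3
      rw [map_zero, map_natCast] at h4
      exact_mod_cast h4.symm
    omega
  rw [zero_mul, zero_add, mul_eq_zero, or_iff_left hD] at h0
  exact ⟨rfl, h0⟩

theorem exists_mul_eq_of_mem_F (hdist : IsDistinguished f) (hred : Squarefree f)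
    (hn : 2 ≤ f.natDegree) (r : ℚ) {w : (LaurentSeries ℂ)[X]} (hw : w ∈ F f r) :
    ∃ u ∈ F f (r + 1), ∃ v ∈ EGt f r,
      w * toK f = u * toK (derivX f) + v * toK (derivY f) := by
  have hf : (toK f).degree < (f.natDegree + 1 : ℕ) := by
    rw [degree_toK]
    exact degree_le_natDegree.trans_lt (by exact_mod_cast Nat.lt_succ_self _)
  obtain ⟨u, hu, v, hv, h⟩ := exists_eq_mul_derivX_add_mul_derivY hdist hred hn
    (p := w * toK f) (mem_degreeLT.2 ((degree_mul_lt (mem_degreeLT.1 hw.1) hf).trans_le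
      (by exact_mod_cast (by omega))))
  obtain ⟨h1, h2⟩ := le_val_and_lt_val_of_mul_eq hdist hred hu hv h hw.2
  exact ⟨u, ⟨hu, h1⟩, v, ⟨hv, h2⟩, h⟩

/-- Both the coordinates of `w` and the roots are integral, so the Lagrange expansion has integral
coefficients. -/
theorem exists_toK_eq_of_mem_E (hdist : IsDistinguished f) (hred : Squarefree f)
    {w : (LaurentSeries ℂ)[X]} (hw : w ∈ E f 0) : ∃ W, toK W = w := by
  classical
  have hm := hdist.1
  refine exists_toK_eq fun i => ?_
  have hexp := eq_sum_nodal_erase (s := branches f) (g := w.map (ramify 1)) coe_injOn_branches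
    (by rw [card_branches hm hred, degree_map]; exact mem_degreeLT.1 hw.1)
  have hmem : w.map (ramify 1) ∈ lifts integers.subtype := by
    rw [hexp]
    have hC : ∀ y : HahnSeries ℚ ℂ, 0 ≤ y.orderTop → C y ∈ lifts integers.subtype := fun y hy =>
      C'_mem_lifts ⟨⟨y, mem_integers.2 hy⟩, rfl⟩
    refine sum_mem fun a ha => mul_mem (hC _ ?_) (prod_mem fun b hb => ?_)
    · have := le_val_iff.1 hw.2 a ha
      rw [coord, map_derivY hm hred] at this
      exact this
    · rw [sub_eq_add_neg, ← C_neg]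
      refine add_mem (X_mem_lifts _) (hC _ ?_)
      rw [HahnSeries.orderTop_neg]
      exact (orderTop_branch_pos hdist hred (Finset.mem_of_mem_erase hb)).le
  rw [lifts_iff_coeff_lifts] at hmem
  obtain ⟨y, hy⟩ := hmem i
  rw [← coeff_map, ← hy]
  exact mem_integers.1 y.2

theorem mul_mem_jacobianIdeal_of_toK_mem_E (hdist : IsDistinguished f) (hred : Squarefree f)
    (hn : 2 ≤ f.natDegree) {W : (PowerSeries ℂ)[X]} (hW : toK W ∈ E f 0) :
    W * f ∈ jacobianIdeal f := by
  have hm := hdist.1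
  obtain ⟨hd1, hd2⟩ := derivative_bounds hm hn
  have hn0 : (f.natDegree : ℂ) ≠ 0 := by exact_mod_cast (by omega : f.natDegree ≠ 0)
  have hval := le_val_iff.1 hW.2
  have hdW : W.degree < f.natDegree := by
    rw [← degree_toK]; exact mem_degreeLT.1 hW.1
  -- Chosen so that `W - c f'_y` loses its term of degree `n - 1`. All coordinates of `f'_y` are
  -- `1`, so those of `W` are only shifted by the integral `c`.
  set c : PowerSeries ℂ := PowerSeries.C (f.natDegree : ℂ)⁻¹ * W.coeff (f.natDegree - 1) with hc
  have hcn : c * f.natDegree = W.coeff (f.natDegree - 1) := by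
    have : PowerSeries.C (f.natDegree : ℂ)⁻¹ * (f.natDegree : PowerSeries ℂ) = 1 := by
      rw [← map_natCast (PowerSeries.C (R := ℂ)), ← map_mul, inv_mul_cancel₀ hn0, map_one]
    rw [hc, mul_right_comm, this, one_mul]
  have hF : toK (W - C c * derivY f) ∈ F f 0 := by
    refine ⟨?_, le_val_iff.2 fun a ha => ?_⟩
    · rw [mem_degreeLT, degree_toK, degree_lt_iff_coeff_zero]
      intro k hk
      rw [coeff_sub, coeff_C_mul]
      rcases hk.lt_or_eq with h | rfl
      · have h : (f.natDegree : WithBot ℕ) ≤ k := by exact_mod_cast (by omega)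
        rw [coeff_eq_zero_of_degree_lt (hdW.trans_le h), coeff_eq_zero_of_degree_lt (hd1.trans_le h),
          mul_zero, sub_zero]
      · rw [hd2, hcn, sub_self]
    · have hD0 : ((derivY f).map toHahn).eval (a : HahnSeries ℚ ℂ) ≠ 0 := by
        classical
        rw [map_derivY hm hred]
        exact derivative_nodal_eval_ne_zero coe_injOn_branches ha
      have h1 : coord f (toK (W - C c * derivY f)) a = coord f (toK W) a - toHahn c := by
        simp only [coord, map_toK, Polynomial.map_sub, Polynomial.map_mul, Polynomial.map_C,
          eval_sub, eval_mul, eval_C]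
        field_simp
      rw [h1]
      exact mem_integers.1 (integers.sub_mem (mem_integers.2 (hval a ha))
        (mem_integers.2 (orderTop_toHahn_nonneg c)))
  obtain ⟨u, hu, v, hv, h⟩ := exists_mul_eq_of_mem_F hdist hred hn 0 hF
  obtain ⟨U, rfl⟩ := exists_toK_eq_of_mem_E hdist hred (w := u)
    ⟨degreeLT_mono (Nat.sub_le _ _) hu.1, le_trans (by norm_num) hu.2⟩
  obtain ⟨V, rfl⟩ := exists_toK_eq_of_mem_E hdist hred (w := v) ⟨hv.1, hv.2.le⟩
  rw [← map_mul, ← map_mul, ← map_mul, ← map_add] at h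
  have h := toK_injective h
  rw [jacobianIdeal, Ideal.mem_span_pair]
  exact ⟨U, V + C c * f, by linear_combination -h⟩

/-- The polynomial `f - (y/n) f'_y` has degree less than `n` and coordinates `-a_i/n`, hence lies in
`E_0`; it differs from `f` by a multiple of `f'_y`. -/
theorem sq_mem_jacobianIdeal (hdist : IsDistinguished f) (hred : Squarefree f)
    (hn : 2 ≤ f.natDegree) : f ^ 2 ∈ jacobianIdeal f := by
  have hm := hdist.1
  obtain ⟨hd1, hd2⟩ := derivative_bounds hm hn
  have hn0 : (f.natDegree : ℂ) ≠ 0 := by exact_mod_cast (by omega : f.natDegree ≠ 0)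
  set e : PowerSeries ℂ := PowerSeries.C (f.natDegree : ℂ)⁻¹ with he
  have hen : e * f.natDegree = 1 := by
    rw [he, ← map_natCast (PowerSeries.C (R := ℂ)), ← map_mul, inv_mul_cancel₀ hn0, map_one]
  have hE : toK (f - C e * X * derivY f) ∈ E f 0 := by
    refine ⟨?_, le_val_iff.2 fun a ha => ?_⟩
    · rw [mem_degreeLT, degree_toK, degree_lt_iff_coeff_zero]
      intro k hk
      obtain ⟨j, rfl⟩ : ∃ j, k = j + 1 := ⟨k - 1, by omega⟩
      rw [coeff_sub, mul_assoc, coeff_C_mul, coeff_X_mul]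
      rcases hk.lt_or_eq with h | h
      · have h' : (f.natDegree : WithBot ℕ) ≤ j := by exact_mod_cast (by omega)
        rw [coeff_eq_zero_of_natDegree_lt h, coeff_eq_zero_of_degree_lt (hd1.trans_le h'),
          mul_zero, sub_zero]
      · have hj : j = f.natDegree - 1 := by omega
        rw [← h, hm.coeff_natDegree, hj, hd2, hen, sub_self]
    · have hD0 : ((derivY f).map toHahn).eval (a : HahnSeries ℚ ℂ) ≠ 0 := by
        classical
        rw [map_derivY hm hred]
        exact derivative_nodal_eval_ne_zero coe_injOn_branches ha
      have hf0 : (f.map toHahn).eval (a : HahnSeries ℚ ℂ) = 0 := by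
        rw [map_toHahn_eq_nodal hm hred]
        exact Lagrange.eval_nodal_at_node ha
      have h1 : coord f (toK (f - C e * X * derivY f)) a = -(toHahn e * a) := by
        simp only [coord, map_toK, Polynomial.map_sub, Polynomial.map_mul, Polynomial.map_C,
          Polynomial.map_X, eval_sub, eval_mul, eval_C, eval_X, hf0]
        field_simp
        ring
      rw [h1]
      exact mem_integers.1 (integers.neg_mem (integers.mul_mem
        (mem_integers.2 (orderTop_toHahn_nonneg e))
        (mem_integers.2 (orderTop_branch_pos hdist hred ha).le)))
  have h := mul_mem_jacobianIdeal_of_toK_mem_E hdist hred hn hE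
  have h2 : derivY f ∈ jacobianIdeal f := Ideal.subset_span (by simp)
  have : f ^ 2 = (f - C e * X * derivY f) * f + (C e * X * f) * derivY f := by ring
  rw [this]
  exact add_mem h (Ideal.mul_mem_left _ _ h2)

end

end JacobianDivision

end

open JacobianDivision
theorem mainTheorem5 (f : Polynomial (PowerSeries ℂ)) (hn : 2 ≤ f.natDegree)
    (hdist : IsDistinguished f) (hred : Squarefree f) :
    (∀ r : ℚ, (∃ k : ℤ, r = (k : ℚ) / (lcmFactorDegrees f : ℚ)) →
      ∀ w ∈ F f r, ∃ u ∈ F f (r + 1), ∃ v ∈ EGt f r,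
        w * toK f = u * toK (derivX f) + v * toK (derivY f)) ∧
    (∀ w ∈ E f 0, ∃ W : Polynomial (PowerSeries ℂ),
      toK W = w ∧ W * f ∈ jacobianIdeal f) ∧
    f ^ 2 ∈ jacobianIdeal f := by
  refine ⟨fun r _ w hw => exists_mul_eq_of_mem_F hdist hred hn r hw, fun w hw => ?_,
    sq_mem_jacobianIdeal hdist hred hn⟩
  obtain ⟨W, rfl⟩ := exists_toK_eq_of_mem_E hdist hred hw
  exact ⟨W, rfl, mul_mem_jacobianIdeal_of_toK_mem_E hdist hred hn hw⟩
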